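/- For integers $n,m\ge 1$ let $\mathrm{PARITY}_n(y)=y_1\oplus\dots\oplus y_n$ for $y\in\{0,1\}^n$, and let the partial function $\mathrm{OR}_m$ be defined on the strings $z\in\{0,1\}^m$ with at most one non-zero bit by $\mathrm{OR}_m(z)=z_1\lor\dots\lor z_m$. Let $f_{n,m}(X)=\mathrm{PARITY}_n(\mathrm{OR}_m(X_1),\dots,\mathrm{OR}_m(X_n))$, a partial Boolean function of $X=(X_1,\dots,X_n)=(x_{t,i})_{t\in[n],i\in[m]}$ defined when every block $X_t$ has at most one non-zero bit. A $T$-query quantum algorithm consists of a finite-dimensional workspace, an initial unit vector, unitaries $U_0,\dots,U_T$ and an orthogonal projection $\Pi$, all independent of $X$. It prepares $|\psi_X\rangle=U_T\mathcal{O}_XU_{T-1}\cdots\mathcal{O}_XU_0|\mathrm{init}\rangle$, where $\mathcal{O}_X|k,i,t\rangle=|k\oplus x_{t,i},i,t\rangle$ for $k\in\{0,1\}$, $i\in[m]$, $t\in[n]$, acting as the identity on the workspace, and the projective measurement $\{\Pi,I-\Pi\}$ is then performed on $\rho_X=|\psi_X\rangle\langle\psi_X|$. It solves $f_{n,m}$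 with unbounded error if there is an $\varepsilon>0$ (arbitrarily small, possibly depending on $n$ and $m$) such that for every $X$ in the domain of $f_{n,m}$, $\mathrm{Tr}[\rho_X\Pi]\ge\frac12+\varepsilon$ if $f_{n,m}(X)=1$ and $\mathrm{Tr}[\rho_X\Pi]\le\frac12-\varepsilon$ if $f_{n,m}(X)=0$. The unbounded-error quantum query complexity $\mathsf{UQ}(f_{n,m})$ is the least $T$ for which such a $T$-query algorithm exists. Then $\mathsf{UQ}(f_{n,m})=\Theta(n)$, independently of $m$: there are absolute constants $c,C>0$ such that for all integers $n,m\ge1$ the number $\mathsf{UQ}(f_{n,m})$ is finite and $c\,n\le\mathsf{UQ}(f_{n,m})\le C\,n$. -/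

import Mathlib

/-! ### Quantum query algorithms -/

/-- Labels of the computational basis of a query algorithm: an answer bit `k`, a query index `i : I`
and the content of a workspace register of finite dimension `w`. -/
abbrev QueryBasis (I : Type) (w : ℕ) : Type := Bool × I × Fin w

/-- The oracle of the input `x`, acting on the computational basis by
`|k, i, a⟩ ↦ |k ⊕ x i, i, a⟩`; the entry in row `r` and column `c` is `⟨r| O_x |c⟩`. -/
def queryOracle {I : Type} [DecidableEq I] (w : ℕ) (x : I → Bool) :
    Matrix (QueryBasis I w) (QueryBasis I w) ℂ :=
  Matrix.of fun r c => if r = (Bool.xor c.1 (x c.2.1), c.2.1, c.2.2) then 1 else 0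

/-- A quantum query algorithm with query indices in `I`: a workspace dimension, an initial unit
vector, the input-independent unitaries (`unitary 0` is applied before the first query, and
`unitary (j + 1)` directly after query number `j + 1`), and an orthogonal projection, the
measurement operator of outcome `1`. A run with `T` queries uses `unitary 0, …, unitary T`. -/
structure QueryAlgorithm (I : Type) [Fintype I] [DecidableEq I] where
  workDim : ℕ
  init : QueryBasis I workDim → ℂ
  init_unit : star init ⬝ᵥ init = 1
  unitary : ℕ → Matrix.unitaryGroup (QueryBasis I workDim) ℂ
  proj : Matrix (QueryBasis I workDim) (QueryBasis I workDim) ℂ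
  proj_isStarProjection : IsStarProjection proj

namespace QueryAlgorithm

variable {I : Type} [Fintype I] [DecidableEq I]

/-- The state vector `U_T O_x U_{T-1} ⋯ O_x U_0 |init⟩` on input `x` after `T` queries. -/
def state (A : QueryAlgorithm I) (x : I → Bool) : ℕ → QueryBasis I A.workDim → ℂ
  | 0 => Matrix.mulVec (A.unitary 0 : Matrix _ _ ℂ) A.init
  | T + 1 => Matrix.mulVec (A.unitary (T + 1) : Matrix _ _ ℂ)
      (Matrix.mulVec (queryOracle A.workDim x) (A.state x T))

/-- The density matrix `ρ = |ψ⟩⟨ψ|` prepared on input `x` with `T` queries. -/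
def density (A : QueryAlgorithm I) (x : I → Bool) (T : ℕ) :
    Matrix (QueryBasis I A.workDim) (QueryBasis I A.workDim) ℂ :=
  Matrix.vecMulVec (A.state x T) (star (A.state x T))

/-- The probability `Tr[ρ Π]` of outcome `1` on input `x` after `T` queries (the trace is real). -/
def outputOneProb (A : QueryAlgorithm I) (x : I → Bool) (T : ℕ) : ℝ :=
  (Matrix.trace (A.density x T * A.proj)).re

/-- The algorithm, run with `T` queries, solves the partial Boolean function `f` with unbounded
error: for some `ε > 0`, arbitrarily small, outcome `1` has probability at least `1/2 + ε` on the
allowed inputs with `f x = 1` and at most `1/2 - ε` on those with `f x = 0`. -/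
def SolvesUnbounded (A : QueryAlgorithm I) (T : ℕ) (f : (I → Bool) →. Bool) : Prop :=
  ∃ ε : ℝ, 0 < ε ∧ ∀ x : I → Bool,
    (true ∈ f x → 1 / 2 + ε ≤ A.outputOneProb x T) ∧
    (false ∈ f x → A.outputOneProb x T ≤ 1 / 2 - ε)

end QueryAlgorithm

/-- The unbounded-error quantum query complexity of a partial Boolean function: the least number of
queries with which some algorithm solves it with unbounded error (`⊤` if there is none). -/
noncomputable def UQ {I : Type} [Fintype I] [DecidableEq I] (f : (I → Bool) →. Bool) : ℕ∞ :=
  ⨅ (T : ℕ) (_ : ∃ A : QueryAlgorithm I, A.SolvesUnbounded T f), (T : ℕ∞)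

/-! ### The Boolean functions -/

/-- `PARITY_n (y) = y₁ ⊕ ⋯ ⊕ yₙ`. -/
def parity (n : ℕ) (y : Fin n → Bool) : Bool :=
  (List.ofFn y).foldr Bool.xor false

/-- The partial function `OR_m`, defined on the strings with at most one non-zero bit. -/
def partialOr (m : ℕ) : (Fin m → Bool) →. Bool := fun y =>
  { Dom := ∀ i j : Fin m, y i = true → y j = true → i = j
    get := fun _ => decide (∃ i : Fin m, y i = true) }

/-- The composition `PARITY_n ∘ (partial OR_m)`, with input bits `x (t, i)`. It is defined when
every block `x (t, ·)` is in the domain of the partial `OR_m`. -/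
def parityOr (n m : ℕ) : (Fin n × Fin m → Bool) →. Bool := fun x =>
  { Dom := ∀ t : Fin n, (partialOr m fun i => x (t, i)).Dom
    get := fun h => parity n fun t => (partialOr m fun i => x (t, i)).get (h t) }

/-!
The value `q = UQ (parityOr n m)` satisfies `n / 2 ≤ q ≤ n`.

*Upper bound.* A randomized algorithm may query one uniformly random bit of every block. In a block
of length `m`, draw a uniform element of `Fin m ⊕ Fin (m - 1)`: on `inl s` query the bit `s` and
answer with it, on `inr _` answer `1` regardless. If the block has at most one non-zero bit, the
signs `(-1) ^ answer`, summed over the `2 m - 1` outcomes, give exactly `(-1) ^ OR`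
(`sum_boolSign_blockAnswer`): the sum is `m - (m - 1)` for the zero block, and a non-zero bit changes
one summand from `1` to `-1`. The blocks are independent, so the parity of the answers has bias
exactly `(2 m - 1) ^ (-n)` towards the parity of the `OR`s. Such a non-adaptive algorithm with `T`
queries is simulated by permutation matrices acting on a uniform superposition of its random seeds
(`outputOneProb_sampler`).

*Lower bound.* This is the polynomial method. After `T` queries every amplitude is a linear
combination of functions of at most `T` input bits, so the acceptance probability is a combination of
functions of at most `2 T` input bits (`outputOneProb_mem_juntaSpan`). If `2 T < n`, then on inputs
supported on the first bit of each block it is orthogonal to the parity function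
(`sum_boolSign_parity_mul_eq_zero`), whereas for an algorithm that solves the problem every term of
that correlation, taken after subtracting `1 / 2`, has the same strict sign.
-/

/-! ### Parity and signs -/

/-- The sign `(-1) ^ b` of a bit `b`. -/
def boolSign (b : Bool) : ℝ := if b then -1 else 1

lemma boolSign_xor (a b : Bool) : boolSign (Bool.xor a b) = boolSign a * boolSign b := by
  cases a <;> cases b <;> simp [boolSign]

lemma boolSign_parity (n : ℕ) (y : Fin n → Bool) :
    boolSign (parity n y) = ∏ t, boolSign (y t) := by
  induction n with
  | zero => simp [parity, boolSign]
  | succ n ih =>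
    rw [Fin.prod_univ_succ, ← ih (fun t => y t.succ), ← boolSign_xor]
    simp [parity, List.ofFn_succ]

lemma boolSign_parity_update_not {n : ℕ} (y : Fin n → Bool) (t : Fin n) :
    boolSign (parity n (Function.update y t (!y t))) = -boolSign (parity n y) := by
  rw [boolSign_parity, boolSign_parity, ← Finset.mul_prod_erase _ _ (Finset.mem_univ t),
    ← Finset.mul_prod_erase Finset.univ (fun i => boolSign (y i)) (Finset.mem_univ t),
    Finset.prod_congr rfl (g := fun i => boolSign (y i))]
  · cases h : y t <;> simp [boolSign]
  · intro i hi
    rw [Function.update_of_ne (Finset.ne_of_mem_erase hi)]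

/-! ### The polynomial method -/

/-- The linear span of the functions `(I → Bool) → ℂ` that depend on at most `d` of the input bits;
these are the functions that are polynomials of degree at most `d` in the bits. -/
def juntaSpan (I : Type) (d : ℕ) : Submodule ℂ ((I → Bool) → ℂ) :=
  Submodule.span ℂ {F | ∃ S : Finset I, S.card ≤ d ∧ DependsOn F (S : Set I)}

section PolynomialMethod

variable {I : Type}

lemma mem_juntaSpan_of_dependsOn {d : ℕ} {F : (I → Bool) → ℂ} (S : Finset I) (hS : S.card ≤ d)
    (hF : DependsOn F (S : Set I)) : F ∈ juntaSpan I d :=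
  Submodule.subset_span ⟨S, hS, hF⟩

lemma const_mem_juntaSpan (d : ℕ) (c : ℂ) : (fun _ => c) ∈ juntaSpan I d :=
  mem_juntaSpan_of_dependsOn ∅ (by simp) (fun _ _ _ => rfl)

lemma mul_mem_juntaSpan [DecidableEq I] {d e : ℕ} {F G : (I → Bool) → ℂ}
    (hF : F ∈ juntaSpan I d) (hG : G ∈ juntaSpan I e) : F * G ∈ juntaSpan I (d + e) := by
  have h := Submodule.mul_mem_mul hF hG
  rw [juntaSpan, juntaSpan, Submodule.span_mul_span] at h
  refine Submodule.span_mono ?_ h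
  rintro _ ⟨F, ⟨S, hS, hF⟩, G, ⟨S', hS', hG⟩, rfl⟩
  refine ⟨S ∪ S', (Finset.card_union_le _ _).trans (by omega), fun x y hxy => ?_⟩
  have h1 : F x = F y := hF fun i hi => hxy i (by simp [Finset.mem_coe.1 hi])
  have h2 : G x = G y := hG fun i hi => hxy i (by simp [Finset.mem_coe.1 hi])
  simp [h1, h2]

lemma star_mem_juntaSpan {d : ℕ} {F : (I → Bool) → ℂ} (hF : F ∈ juntaSpan I d) :
    star F ∈ juntaSpan I d := by
  induction hF using Submodule.span_induction with
  | mem F h =>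
    obtain ⟨S, hS, hF⟩ := h
    exact mem_juntaSpan_of_dependsOn S hS fun x y hxy => by simp [hF hxy]
  | zero => simp
  | add F G _ _ hF hG => simpa using add_mem hF hG
  | smul c F _ hF => simpa using Submodule.smul_mem _ (star c) hF

lemma mulVec_mem_juntaSpan {κ : Type} [Fintype κ] {d : ℕ} (M : Matrix κ κ ℂ)
    {v : (I → Bool) → κ → ℂ} (hv : ∀ r, (fun x => v x r) ∈ juntaSpan I d) (r : κ) :
    (fun x => Matrix.mulVec M (v x) r) ∈ juntaSpan I d := by
  have : (fun x => Matrix.mulVec M (v x) r) = ∑ c, M r c • fun x => v x c := by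
    ext x
    simp [Matrix.mulVec, dotProduct]
  rw [this]
  exact Submodule.sum_mem _ fun c _ => Submodule.smul_mem _ _ (hv c)

variable [Fintype I] [DecidableEq I]

/-- The matrix of an involution of the basis acts on vectors by precomposition. -/
lemma involutive_mulVec {κ : Type} [Fintype κ] [DecidableEq κ] {f : κ → κ}
    (hf : Function.Involutive f) (v : κ → ℂ) :
    Matrix.mulVec (Matrix.of fun r c => if r = f c then (1 : ℂ) else 0) v = v ∘ f := by
  ext r
  have h : ∀ c, (r = f c) ↔ (c = f r) := fun c => by rw [eq_comm, hf.eq_iff]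
  simp [Matrix.mulVec, dotProduct, h]

/-- The action of the oracle of the input `x` on basis labels. -/
def oracleMap {w : ℕ} (x : I → Bool) (c : QueryBasis I w) : QueryBasis I w :=
  (Bool.xor c.1 (x c.2.1), c.2.1, c.2.2)

omit [Fintype I] [DecidableEq I] in
lemma oracleMap_involutive {w : ℕ} (x : I → Bool) :
    Function.Involutive (oracleMap x : QueryBasis I w → QueryBasis I w) := by
  rintro ⟨k, i, a⟩
  simp [oracleMap]

lemma queryOracle_mulVec {w : ℕ} (x : I → Bool) (v : QueryBasis I w → ℂ) :
    Matrix.mulVec (queryOracle w x) v = v ∘ oracleMap x :=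
  involutive_mulVec (oracleMap_involutive x) v

/-- Every amplitude after `T` queries has degree at most `T` in the input bits: a query replaces the
amplitude of `|k, i, a⟩` by that of `|k, i, a⟩` or of `|!k, i, a⟩`, selected by the bit `x i`. -/
lemma state_mem_juntaSpan (A : QueryAlgorithm I) (T : ℕ) (r : QueryBasis I A.workDim) :
    (fun x => A.state x T r) ∈ juntaSpan I T := by
  induction T generalizing r with
  | zero => exact const_mem_juntaSpan 0 _
  | succ T ih =>
    refine mulVec_mem_juntaSpan _ (v := fun x => Matrix.mulVec (queryOracle A.workDim x)
      (A.state x T)) (fun r => ?_) r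
    obtain ⟨k, i, a⟩ := r
    have hbit : ∀ b : Bool, (fun x : I → Bool => if x i = b then (1 : ℂ) else 0) ∈
        juntaSpan I 1 := fun b =>
      mem_juntaSpan_of_dependsOn {i} (by simp) fun x y hxy => by
        simp [hxy i (by simp)]
    have hsum : (fun x => Matrix.mulVec (queryOracle A.workDim x) (A.state x T) (k, i, a)) =
        (fun x => A.state x T (k, i, a)) * (fun x => if x i = false then (1 : ℂ) else 0) +
        (fun x => A.state x T (!k, i, a)) * (fun x => if x i = true then (1 : ℂ) else 0) := by
      ext x
      rw [queryOracle_mulVec]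
      cases h : x i <;> simp [oracleMap, h]
    rw [hsum]
    exact add_mem (mul_mem_juntaSpan (ih _) (hbit _)) (mul_mem_juntaSpan (ih _) (hbit _))

/-- The acceptance probability after `T` queries has degree at most `2 T` in the input bits. -/
lemma outputOneProb_mem_juntaSpan (A : QueryAlgorithm I) (T : ℕ) :
    (fun x => Matrix.trace (A.density x T * A.proj)) ∈ juntaSpan I (T + T) := by
  have : (fun x => Matrix.trace (A.density x T * A.proj)) =
      ∑ r, ∑ c, A.proj c r • ((fun x => A.state x T r) * star (fun x => A.state x T c)) := by
    ext x
    simp [Matrix.trace, Matrix.mul_apply, QueryAlgorithm.density, Matrix.vecMulVec_apply, mul_comm]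
  rw [this]
  exact Submodule.sum_mem _ fun r _ => Submodule.sum_mem _ fun c _ => Submodule.smul_mem _ _
    (mul_mem_juntaSpan (state_mem_juntaSpan A T r) (star_mem_juntaSpan (state_mem_juntaSpan A T c)))

end PolynomialMethod

/-! ### The lower bound -/

/-- The input whose block `t` has the bit `y t` in position `i₀` and zeros elsewhere. -/
def singleBitInput {n m : ℕ} (i₀ : Fin m) (y : Fin n → Bool) : Fin n × Fin m → Bool :=
  fun p => decide (p.2 = i₀) && y p.1

lemma parity_mem_parityOr_singleBitInput {n m : ℕ} (i₀ : Fin m) (y : Fin n → Bool) :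
    parity n y ∈ parityOr n m (singleBitInput i₀ y) := by
  refine ⟨fun t i j hi hj => ?_, ?_⟩
  · simp only [singleBitInput, Bool.and_eq_true, decide_eq_true_eq] at hi hj
    rw [hi.1, hj.1]
  · change parity n _ = parity n y
    congr 1
    ext t
    simp [partialOr, singleBitInput]

/-- Functions of degree less than `n` are orthogonal to the parity of `n` bits: a function of fewer
than `n` bits misses a block, and flipping the bit of that block pairs terms of opposite sign. -/
lemma sum_boolSign_parity_mul_eq_zero {n m d : ℕ} (hd : d < n) (i₀ : Fin m)
    {F : (Fin n × Fin m → Bool) → ℂ} (hF : F ∈ juntaSpan (Fin n × Fin m) d) :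
    ∑ y : Fin n → Bool, (boolSign (parity n y) : ℂ) * F (singleBitInput i₀ y) = 0 := by
  induction hF using Submodule.span_induction with
  | mem F h =>
    obtain ⟨S, hS, hF⟩ := h
    obtain ⟨t, ht⟩ : ∃ t, t ∉ S.image Prod.fst := by
      by_contra! h
      have h1 := Finset.card_le_card (fun t _ => h t : Finset.univ ⊆ S.image Prod.fst)
      have h2 := Finset.card_image_le (s := S) (f := Prod.fst)
      rw [Finset.card_univ, Fintype.card_fin] at h1
      omega
    have hinv : ∀ y : Fin n → Bool, F (singleBitInput i₀ (Function.update y t (!y t))) =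
        F (singleBitInput i₀ y) := fun y => hF fun p hp => by
      have : p.1 ≠ t := fun h => ht (h ▸ Finset.mem_image_of_mem _ hp)
      simp [singleBitInput, Function.update_of_ne this]
    refine Finset.sum_involution (fun y _ => Function.update y t (!y t)) ?_ ?_ ?_ ?_
    · intro y _
      rw [hinv, boolSign_parity_update_not]
      push_cast
      ring
    · intro y _ _ h
      simpa using congrFun h t
    · simp
    · simp
  | zero => simp
  | add F G _ _ hF hG => simp [mul_add, Finset.sum_add_distrib, hF, hG]
  | smul c F _ hF =>
    have : ∀ y : Fin n → Bool, (boolSign (parity n y) : ℂ) * (c • F) (singleBitInput i₀ y) =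
        c * ((boolSign (parity n y) : ℂ) * F (singleBitInput i₀ y)) := fun y => by
      simp only [Pi.smul_apply, smul_eq_mul]
      ring
    rw [Finset.sum_congr rfl fun y _ => this y, ← Finset.mul_sum, hF, mul_zero]

/-- An unbounded-error algorithm for `PARITY_n ∘ OR_m` makes at least `n / 2` queries. -/
lemma le_two_mul_of_solvesUnbounded {n m T : ℕ} (hm : 1 ≤ m)
    (A : QueryAlgorithm (Fin n × Fin m)) (hA : A.SolvesUnbounded T (parityOr n m)) :
    n ≤ T + T := by
  by_contra! hT
  obtain ⟨ε, hε, hA⟩ := hA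
  let i₀ : Fin m := ⟨0, hm⟩
  have hsum := sum_boolSign_parity_mul_eq_zero hT i₀
    (sub_mem (outputOneProb_mem_juntaSpan A T) (const_mem_juntaSpan (T + T) (1 / 2 : ℝ)))
  have hneg : ∑ y : Fin n → Bool, boolSign (parity n y) *
      (A.outputOneProb (singleBitInput i₀ y) T - 1 / 2) < 0 := by
    refine Finset.sum_neg (fun y _ => ?_) Finset.univ_nonempty
    have hy := parity_mem_parityOr_singleBitInput i₀ y
    cases h : parity n y <;> rw [h] at hy
    · have := (hA _).2 hy
      simp only [boolSign, Bool.false_eq_true, if_false]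
      linarith
    · have := (hA _).1 hy
      simp only [boolSign, if_true]
      linarith
  have hre := congrArg Complex.re hsum
  rw [Complex.re_sum] at hre
  simp only [Complex.re_ofReal_mul, Pi.sub_apply, Complex.sub_re, Complex.ofReal_re,
    Complex.zero_re] at hre
  exact hneg.ne hre

/-! ### Simulating a non-adaptive randomized algorithm -/

section Sampler

variable {I : Type} [Fintype I] [DecidableEq I]

/-- The matrix of an involution of the basis, as a unitary. -/
def involutionUnitary {κ : Type} [Fintype κ] [DecidableEq κ] (f : κ → κ)
    (hf : Function.Involutive f) : Matrix.unitaryGroup κ ℂ :=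
  ⟨Matrix.of fun r c => if r = f c then (1 : ℂ) else 0, by
    rw [Matrix.mem_unitaryGroup_iff]
    have hstar : star (Matrix.of fun r c => if r = f c then (1 : ℂ) else 0) =
        Matrix.of fun r c => if r = f c then (1 : ℂ) else 0 := by
      ext r c
      have h : (c = f r) ↔ (r = f c) := by rw [eq_comm, hf.eq_iff]
      simp [Matrix.star_apply, h, apply_ite]
    rw [hstar]
    refine Matrix.ext_of_mulVec_single fun c => ?_
    rw [← Matrix.mulVec_mulVec, involutive_mulVec hf, involutive_mulVec hf, Matrix.one_mulVec,
      Function.comp_assoc, hf.comp_self, Function.comp_id]⟩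

lemma involutionUnitary_mulVec {κ : Type} [Fintype κ] [DecidableEq κ] {f : κ → κ}
    (hf : Function.Involutive f) (v : κ → ℂ) :
    Matrix.mulVec (involutionUnitary f hf : Matrix κ κ ℂ) v = v ∘ f :=
  involutive_mulVec hf v

variable {Ω : Type} [Fintype Ω] {T : ℕ}

/-- The dimension of the workspace that holds a seed in `Ω` and a record of `T` answers. -/
abbrev samplerDim (Ω : Type) [Fintype Ω] (T : ℕ) : ℕ := Fintype.card (Ω × (Fin T → Bool))

/-- The decoding of the workspace into a seed and a record of answers. -/
noncomputable def samplerDecode (Ω : Type) [Fintype Ω] (T : ℕ) :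
    Fin (samplerDim Ω T) ≃ Ω × (Fin T → Bool) :=
  (Fintype.equivFin _).symm

/-- The seed held in the workspace. -/
noncomputable def samplerSeed (r : QueryBasis I (samplerDim Ω T)) : Ω :=
  (samplerDecode Ω T r.2.2).1

/-- The basis label with zero answer bit that the sampler reaches on seed `ω` and input `x` after
`j` queries: the query register holds the next index, and the first `j` answers are recorded. -/
noncomputable def samplerLabel (a : ℕ → Ω → I) (x : I → Bool) (j : ℕ) (ω : Ω) :
    QueryBasis I (samplerDim Ω T) :=
  (false, a j ω, (samplerDecode Ω T).symm
    (ω, fun t : Fin T => decide ((t : ℕ) < j) && x (a t ω)))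

/-- The step after query number `j + 1`: exchange the answer bit with entry `j` of the record, and
exchange the indices number `j` and `j + 1` in the query register. -/
noncomputable def samplerStep (a : ℕ → Ω → I) (j : Fin T) (r : QueryBasis I (samplerDim Ω T)) :
    QueryBasis I (samplerDim Ω T) :=
  let s := samplerDecode Ω T r.2.2
  (s.2 j, Equiv.swap (a j s.1) (a (j + 1) s.1) r.2.1,
    (samplerDecode Ω T).symm (s.1, Function.update s.2 j r.1))

omit [Fintype I] in
lemma samplerStep_involutive (a : ℕ → Ω → I) (j : Fin T) :
    Function.Involutive (samplerStep a j) := by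
  rintro ⟨k, i, c⟩
  simp [samplerStep]

omit [Fintype I] in
lemma samplerStep_oracleMap_samplerLabel (a : ℕ → Ω → I) (x : I → Bool) (j : Fin T) (ω : Ω) :
    samplerStep a j (oracleMap x (samplerLabel a x j ω)) = samplerLabel a x (j + 1) ω := by
  simp only [samplerStep, oracleMap, samplerLabel, Equiv.apply_symm_apply, Equiv.swap_apply_left,
    lt_irrefl, decide_false, Bool.false_and, Bool.false_xor]
  congr 4
  ext t
  rcases eq_or_ne t j with rfl | h
  · simp
  · have : (t : ℕ) ≠ j := fun h' => h (Fin.ext h')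
    have : (t : ℕ) < j + 1 ↔ (t : ℕ) < j := by omega
    simp [Function.update_of_ne h, this]

/-- The uniform superposition of the labels `b ω`, where `b ω` holds the seed `ω`. -/
noncomputable def seedSuperposition (b : Ω → QueryBasis I (samplerDim Ω T)) :
    QueryBasis I (samplerDim Ω T) → ℂ :=
  fun r => if r = b (samplerSeed r) then ((√(Fintype.card Ω))⁻¹ : ℝ) else 0

omit [Fintype I] in
lemma seedSuperposition_comp {f : QueryBasis I (samplerDim Ω T) → QueryBasis I (samplerDim Ω T)}
    (hf : Function.Involutive f) (hseed : ∀ r, samplerSeed (f r) = samplerSeed r)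
    (b : Ω → QueryBasis I (samplerDim Ω T)) :
    seedSuperposition b ∘ f = seedSuperposition (f ∘ b) := by
  ext r
  simp [seedSuperposition, hseed, hf.eq_iff]

lemma sum_seedSuperposition {b : Ω → QueryBasis I (samplerDim Ω T)}
    (hb : ∀ ω, samplerSeed (b ω) = ω) (P : QueryBasis I (samplerDim Ω T) → ℂ) :
    ∑ r, seedSuperposition b r * star (seedSuperposition b r) * P r =
      ((Fintype.card Ω : ℝ)⁻¹ : ℝ) * ∑ ω, P (b ω) := by
  have hinj : Function.Injective b := Function.LeftInverse.injective hb
  have h1 : ∀ r, seedSuperposition b r * star (seedSuperposition b r) * P r =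
      if r ∈ Finset.univ.image b then ((Fintype.card Ω : ℝ)⁻¹ : ℝ) * P r else 0 := by
    intro r
    have h2 : r ∈ Finset.univ.image b ↔ r = b (samplerSeed r) := by
      simp only [Finset.mem_image, Finset.mem_univ, true_and]
      exact ⟨fun ⟨ω, h⟩ => by rw [← h, hb], fun h => ⟨_, h.symm⟩⟩
    have h3 : ((√(Fintype.card Ω))⁻¹ : ℝ) * (√(Fintype.card Ω))⁻¹ = (Fintype.card Ω : ℝ)⁻¹ := by
      rw [← mul_inv, Real.mul_self_sqrt (Nat.cast_nonneg _)]
    rw [← h3]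
    by_cases h : r = b (samplerSeed r)
    · rw [if_pos (h2.2 h), seedSuperposition, if_pos h]
      simp
    · rw [if_neg (h2.not.2 h), seedSuperposition, if_neg h]
      simp
  rw [Finset.sum_congr rfl fun r _ => h1 r, Finset.sum_ite_mem, Finset.univ_inter,
    Finset.sum_image hinj.injOn, Finset.mul_sum]

omit [Fintype I] [DecidableEq I] in
lemma samplerSeed_samplerLabel (a : ℕ → Ω → I) (x : I → Bool) (j : ℕ) (ω : Ω) :
    samplerSeed (samplerLabel a x j ω : QueryBasis I (samplerDim Ω T)) = ω := by
  simp [samplerSeed, samplerLabel]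

/-- The query algorithm that simulates the non-adaptive randomized algorithm with uniform seed
`ω : Ω`, query indices `a 0 ω, a 1 ω, …` and verdict `g ω r` on the answers `r`. -/
noncomputable def sampler [Nonempty Ω] (a : ℕ → Ω → I) (g : Ω → (Fin T → Bool) → Bool) :
    QueryAlgorithm I where
  workDim := samplerDim Ω T
  init := seedSuperposition (samplerLabel a (fun _ => false) 0)
  init_unit := by
    have h := sum_seedSuperposition (T := T)
      (samplerSeed_samplerLabel a (fun _ => false) 0) (fun _ => 1)
    simp only [mul_one, Finset.sum_const, Finset.card_univ, nsmul_eq_mul] at h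
    have hc : (Fintype.card Ω : ℂ) ≠ 0 := Nat.cast_ne_zero.2 Fintype.card_ne_zero
    rw [dotProduct_comm, dotProduct]
    refine h.trans ?_
    push_cast
    exact inv_mul_cancel₀ hc
  unitary
    | 0 => 1
    | j + 1 => if h : j < T then involutionUnitary _ (samplerStep_involutive a ⟨j, h⟩) else 1
  proj := Matrix.diagonal fun r =>
    if g (samplerSeed r) (samplerDecode Ω T r.2.2).2 then 1 else 0
  proj_isStarProjection := by
    refine ⟨?_, ?_⟩
    · rw [IsIdempotentElem, Matrix.diagonal_mul_diagonal]
      congr 1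
      ext r
      split_ifs <;> simp
    · rw [IsSelfAdjoint, Matrix.star_eq_conjTranspose, Matrix.diagonal_conjTranspose]
      congr 1
      ext r
      simp only [Pi.star_apply]
      split_ifs <;> simp

lemma state_sampler [Nonempty Ω] (a : ℕ → Ω → I) (g : Ω → (Fin T → Bool) → Bool)
    (x : I → Bool) (j : ℕ) (hj : j ≤ T) :
    (sampler a g).state x j = seedSuperposition (samplerLabel a x j) := by
  induction j with
  | zero =>
    have : samplerLabel (T := T) a x 0 = samplerLabel a (fun _ => false) 0 := by
      ext ω : 1
      simp [samplerLabel]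
    rw [this]
    exact Matrix.one_mulVec _
  | succ j ih =>
    have hU : ((sampler a g).unitary (j + 1)) =
        involutionUnitary _ (samplerStep_involutive a ⟨j, hj⟩) := dif_pos hj
    rw [QueryAlgorithm.state, hU, ih (by omega)]
    refine (involutionUnitary_mulVec _ _).trans ?_
    have hO : Matrix.mulVec (queryOracle (samplerDim Ω T) x)
        (seedSuperposition (samplerLabel a x j)) = _ := queryOracle_mulVec x _
    refine (congrArg (· ∘ samplerStep a ⟨j, hj⟩) hO).trans ?_
    rw [seedSuperposition_comp (oracleMap_involutive x) (fun r => rfl),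
      seedSuperposition_comp (samplerStep_involutive a ⟨j, hj⟩)
        (fun r => by simp [samplerSeed, samplerStep])]
    congr 1
    ext ω : 1
    exact samplerStep_oracleMap_samplerLabel a x ⟨j, hj⟩ ω

/-- The sampler accepts with the probability of the randomized algorithm that it simulates. -/
lemma outputOneProb_sampler [Nonempty Ω] (a : ℕ → Ω → I) (g : Ω → (Fin T → Bool) → Bool)
    (x : I → Bool) :
    (sampler a g).outputOneProb x T =
      (Fintype.card Ω : ℝ)⁻¹ * ∑ ω, if g ω (fun t => x (a t ω)) then 1 else 0 := by
  have h : Matrix.trace ((sampler a g).density x T * (sampler a g).proj) =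
      ((Fintype.card Ω : ℝ)⁻¹ : ℝ) *
        ∑ ω, if g ω (fun t => x (a t ω)) then (1 : ℂ) else 0 := by
    have hs := sum_seedSuperposition (T := T) (samplerSeed_samplerLabel a x T) (fun r =>
      if g (samplerSeed r) (samplerDecode Ω T r.2.2).2 then (1 : ℂ) else 0)
    rw [QueryAlgorithm.density, state_sampler a g x T le_rfl]
    refine Eq.trans ?_ (hs.trans ?_)
    · refine Finset.sum_congr rfl fun r _ => ?_
      refine (Matrix.mul_diagonal _ _ _ _).trans ?_
      rfl
    · simp [samplerSeed, samplerLabel]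
  rw [QueryAlgorithm.outputOneProb, h, Complex.re_ofReal_mul, Complex.re_sum]
  congr 1
  refine Finset.sum_congr rfl fun ω _ => ?_
  split_ifs <;> simp

end Sampler

/-! ### The upper bound -/

/-- The position queried in a block of length `m` under the block seed `c`; the answer to the query
is ignored when `c` comes from the second summand. -/
def blockQuery {m : ℕ} (i₀ : Fin m) (c : Fin m ⊕ Fin (m - 1)) : Fin m :=
  Sum.elim id (fun _ => i₀) c

/-- The answer for a block, given the block seed and the queried bit. -/
def blockAnswer {m : ℕ} (c : Fin m ⊕ Fin (m - 1)) (b : Bool) : Bool :=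
  Sum.elim (fun _ => b) (fun _ => true) c

lemma sum_boolSign_blockAnswer {m : ℕ} (i₀ : Fin m) (y : Fin m → Bool) (hy : (partialOr m y).Dom) :
    ∑ c, boolSign (blockAnswer c (y (blockQuery i₀ c))) = boolSign ((partialOr m y).get hy) := by
  have hm : 1 ≤ m := Nat.one_le_of_lt i₀.2
  have hsign : ∀ i, boolSign (y i) = 1 - 2 * if y i = true then 1 else 0 := fun i => by
    cases y i <;> norm_num [boolSign]
  have hsum : ∑ i, boolSign (y i) = m - 2 * ∑ i, if y i = true then 1 else 0 := by
    simp only [hsign, Finset.sum_sub_distrib, ← Finset.mul_sum]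
    simp
  have hor : (∑ i, if y i = true then (1 : ℝ) else 0) =
      if (∃ i, y i = true) then 1 else 0 := by
    split_ifs with h
    · obtain ⟨i, hi⟩ := h
      rw [Finset.sum_eq_single i (fun j _ hj => if_neg fun h => hj (hy j i h hi)) (by simp),
        if_pos hi]
    · push Not at h
      simp [h]
  have hget : boolSign ((partialOr m y).get hy) =
      1 - 2 * if (∃ i, y i = true) then 1 else 0 := by
    change boolSign (decide (∃ i, y i = true)) = _
    by_cases h : ∃ i, y i = true <;> simp only [h, boolSign] <;> norm_num
  rw [Fintype.sum_sum_type, hget, ← hor]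
  simp only [blockAnswer, blockQuery, Sum.elim_inl, Sum.elim_inr, id, hsum]
  simp only [boolSign, if_true, Finset.sum_const, Finset.card_univ, Fintype.card_fin, nsmul_eq_mul,
    Nat.cast_sub hm, Nat.cast_one]
  ring

/-- `PARITY_n ∘ OR_m` is solved with unbounded error by `n` queries, one to each block. -/
lemma exists_solvesUnbounded_parityOr {n m : ℕ} (hn : 1 ≤ n) (hm : 1 ≤ m) :
    ∃ A : QueryAlgorithm (Fin n × Fin m), A.SolvesUnbounded n (parityOr n m) := by
  let i₀ : Fin m := ⟨0, hm⟩
  let Ω := Fin n → Fin m ⊕ Fin (m - 1)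
  have : Nonempty Ω := ⟨fun _ => Sum.inl i₀⟩
  -- Block `j % n` is queried in step `j`; only the steps `j < n` matter.
  let a : ℕ → Ω → Fin n × Fin m := fun j ω =>
    (⟨j % n, Nat.mod_lt _ hn⟩, blockQuery i₀ (ω ⟨j % n, Nat.mod_lt _ hn⟩))
  let g : Ω → (Fin n → Bool) → Bool := fun ω r => parity n fun t => blockAnswer (ω t) (r t)
  have ha : ∀ (t : Fin n) ω, a t ω = (t, blockQuery i₀ (ω t)) := fun t ω => by
    have : (⟨(t : ℕ) % n, Nat.mod_lt _ hn⟩ : Fin n) = t := Fin.ext (Nat.mod_eq_of_lt t.2)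
    simp only [a, this]
  have hN : (0 : ℝ) < Fintype.card Ω := Nat.cast_pos.2 Fintype.card_pos
  have key : ∀ x, ∀ b ∈ parityOr n m x, (sampler a g).outputOneProb x n =
      1 / 2 - (Fintype.card Ω : ℝ)⁻¹ * boolSign b / 2 := by
    rintro x _ ⟨hx, rfl⟩
    have hite : ∀ b : Bool, (if b then (1 : ℝ) else 0) = (1 - boolSign b) / 2 := fun b => by
      cases b <;> norm_num [boolSign]
    have hprod : ∑ ω : Ω, boolSign (g ω fun t => x (a t ω)) =
        boolSign ((parityOr n m x).get hx) := by
      change _ = boolSign (parity n _)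
      simp only [g, ha, boolSign_parity]
      rw [← Finset.prod_congr rfl fun t _ =>
        sum_boolSign_blockAnswer i₀ (fun i => x (t, i)) (hx t), Fintype.prod_sum]
    rw [outputOneProb_sampler, Finset.sum_congr rfl fun ω _ => hite _, ← Finset.sum_div,
      Finset.sum_sub_distrib, hprod]
    simp only [Finset.sum_const, Finset.card_univ, nsmul_eq_mul, mul_one]
    field_simp
  refine ⟨sampler a g, (Fintype.card Ω : ℝ)⁻¹ / 2, by positivity, fun x => ⟨fun h => ?_, fun h => ?_⟩⟩
  · rw [key x _ h]
    simp only [boolSign, if_true]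
    linarith
  · rw [key x _ h]
    simp only [boolSign, Bool.false_eq_true, if_false]
    linarith

/-! ### The complexity of `PARITY_n ∘ OR_m` -/

/-- The unbounded-error quantum query complexity of `PARITY_n ∘ (partial OR_m)` is finite and `Θ(n)`,
with constants that depend on neither `n` nor `m`. -/
theorem mainTheorem3 :
    ∃ c C : ℝ, 0 < c ∧ 0 < C ∧ ∀ n m : ℕ, 1 ≤ n → 1 ≤ m →
      ∃ q : ℕ, UQ (parityOr n m) = (q : ℕ∞) ∧ c * (n : ℝ) ≤ (q : ℝ) ∧ (q : ℝ) ≤ C * (n : ℝ) := by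
  classical
  refine ⟨1 / 2, 1, by norm_num, by norm_num, fun n m hn hm => ?_⟩
  have hex : ∃ T, ∃ A : QueryAlgorithm (Fin n × Fin m), A.SolvesUnbounded T (parityOr n m) :=
    ⟨n, exists_solvesUnbounded_parityOr hn hm⟩
  obtain ⟨A, hA⟩ := Nat.find_spec hex
  refine ⟨Nat.find hex, ?_, ?_, ?_⟩
  · refine le_antisymm (iInf_le_of_le (Nat.find hex) (iInf_le_of_le (Nat.find_spec hex) le_rfl))
      (le_iInf₂ fun T hT => ?_)
    exact Nat.cast_le.2 (Nat.find_min' hex hT)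
  · have h : (n : ℝ) ≤ Nat.find hex + Nat.find hex := by
      exact_mod_cast le_two_mul_of_solvesUnbounded hm A hA
    linarith
  · rw [one_mul]
    exact Nat.cast_le.2 (Nat.find_min' hex (exists_solvesUnbounded_parityOr hn hm))
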